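/- Let $X$ be a real separated (Hausdorff) locally convex space with topology $\tau$, let $X^*$ be its topological dual with the weak-star topology $w^*$, let $w$ be the weak topology of $X$, and put $Z=X\times X^*$ and $c(x,x^*)=\langle x,x^*\rangle=x^*(x)$. A set $T\subset Z$ is monotone if $c(z-z')\ge 0$ for all $z,z'\in T$. It is representable if $T=[f=c]:=\{z\in Z: f(z)=c(z)\}$ for some proper, convex, $\tau\times w^*$-lower semicontinuous $f:Z\to\overline{\mathbb R}$ with $f\ge c$ on $Z$. For $T\subset Z$ let $c_T(z)=c(z)$ if $z\in T$ and $c_T(z)=+\infty$ otherwise, let $\psi_T=\operatorname{cl}_{\tau\times w^*}\operatorname{conv}c_T$ be the Penot function of $T$, that is, $\psi_T(z)=\inf\{t\in\mathbb R: (z,t)\in \operatorname{cl}\,(\operatorname{conv}(\operatorname{epi}c_T))\}$ with the closure taken in $(Z,\tau\times w^*)\times\mathbb R$, and let $\operatorname{Unit}(T)=\{z\in T: c(z)=1\}$. For a net $(z_i)_{i\in I}$ in $Z$ write $z_i\to^\nu z$ if $c(z_i)\le c(z)$ for all $i\in I$ and $z_i\to z$ with respect to $w\times w^*$. A set $A\subset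 Z$ is $\nu$-closed if it equals the set of all $z\in Z$ for which there is a net $(z_i)$ in $A$ with $z_i\to^\nu z$; a function $f:Z\to\overline{\mathbb R}$ is $\nu$-lsc if $f(z)\le\liminf_i f(z_i)$ whenever $z_i\to^\nu z$. Let $L\subset Z$ be a monotone linear subspace whose positive part $\{z\in L: c(z)>0\}$ is nonempty. Then the following are equivalent: (i) $L$ is representable; (ii) $\operatorname{Unit}([\psi_L=c])\subset L$; (iii) $c_L$ is $\nu$-lsc; (iv) $L$ is $\nu$-closed. -/

import Mathlib

open Filter Topology

universe u

namespace MonoLCS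

/-- The space `Z = X × X*`, where `X` carries its original topology `τ` and `X*` the weak-star
topology; the topology of the product is `τ × w*`.  Operators `T : X ⇉ X*` are identified with
their graphs, that is, with subsets of `Z`. -/
abbrev PhaseSpace (X : Type u) [AddCommGroup X] [Module ℝ X] [TopologicalSpace X] : Type u :=
  X × WeakDual ℝ X

section Definitions

variable {X : Type u} [AddCommGroup X] [Module ℝ X] [TopologicalSpace X]

/-- The duality product `c(x, x*) = ⟨x, x*⟩ = x*(x)`. -/
noncomputable def coupling (z : PhaseSpace X) : ℝ := z.2 z.1

/-- Monotonicity: `⟨x₁ - x₂, x₁* - x₂*⟩ ≥ 0` for all `(x₁, x₁*), (x₂, x₂*)` in the graph. -/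
def IsMonotone (T : Set (PhaseSpace X)) : Prop :=
  ∀ z₁ ∈ T, ∀ z₂ ∈ T, 0 ≤ (z₁.2 - z₂.2) (z₁.1 - z₂.1)

/-- The positive part of a set: `{z ∈ A | c(z) > 0}`. -/
def positivePart (A : Set (PhaseSpace X)) : Set (PhaseSpace X) := {z ∈ A | 0 < coupling z}

/-- The unitary part of a set: `{z ∈ A | c(z) = 1}`. -/
def unitaryPart (A : Set (PhaseSpace X)) : Set (PhaseSpace X) := {z ∈ A | coupling z = 1}

/-- The set `[f = c]`. -/
def eqCoupling (f : PhaseSpace X → EReal) : Set (PhaseSpace X) :=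
  {z | f z = (coupling z : EReal)}

/-- The epigraph `{(z, t) ∈ E × ℝ | f(z) ≤ t}` of an extended real-valued function. -/
def epigraph {E : Type u} (f : E → EReal) : Set (E × ℝ) := {p | f p.1 ≤ (p.2 : EReal)}

/-- Properness: the domain is nonempty and the value `-∞` is not taken. -/
def IsProper {E : Type u} (f : E → EReal) : Prop := (∃ z, f z < ⊤) ∧ ∀ z, f z ≠ ⊥

/-- Membership in the class `𝓡(Z)`: proper, convex, `τ × w*`-lower semicontinuous functions
`f ≥ c`. -/
structure IsRepresentative (f : PhaseSpace X → EReal) : Prop where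
  proper : IsProper f
  convex : Convex ℝ (epigraph f)
  lsc : LowerSemicontinuous f
  coupling_le : ∀ z, (coupling z : EReal) ≤ f z

/-- `T` is representable in `Z` if `T = [f = c]` for some `f ∈ 𝓡(Z)`. -/
def IsRepresentable (T : Set (PhaseSpace X)) : Prop :=
  ∃ f : PhaseSpace X → EReal, IsRepresentative f ∧ T = eqCoupling f

open Classical in
/-- The function `c_T = c + ι_T`: equal to `c` on `T` and to `+∞` off `T`. -/
noncomputable def couplingOn (T : Set (PhaseSpace X)) (z : PhaseSpace X) : EReal :=
  if z ∈ T then (coupling z : EReal) else ⊤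

/-- The lower semicontinuous convex hull
`(cl conv f)(z) = inf {t ∈ ℝ | (z, t) ∈ cl (conv (epi f))}`, the infimum being taken in the
extended reals (so `inf ∅ = +∞`). -/
noncomputable def lscConvexHull {E : Type u} [AddCommGroup E] [Module ℝ E] [TopologicalSpace E]
    (f : E → EReal) (z : E) : EReal :=
  sInf ((fun t : ℝ => (t : EReal)) '' {t : ℝ | (z, t) ∈ closure (convexHull ℝ (epigraph f))})

/-- The Penot function `ψ_T = cl_{τ × w*} conv c_T`. -/
noncomputable def penot (T : Set (PhaseSpace X)) : PhaseSpace X → EReal :=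
  lscConvexHull (couplingOn T)

end Definitions

section NaturalConvergence

variable {X : Type u} [AddCommGroup X] [Module ℝ X] [TopologicalSpace X]

/-- The `w × w*`-natural convergence `ν` of a net `(z_i)` to `z`: `c(z_i) ≤ c(z)` for all `i`, and
`z_i → z` for `w × w*`, where `w` is the weak topology of `X`. -/
def NuTendsto {ι : Type u} [Preorder ι] (zs : ι → PhaseSpace X) (z : PhaseSpace X) : Prop :=
  (∀ i, coupling (zs i) ≤ coupling z) ∧
    Tendsto (fun i => ((toWeakSpace ℝ X (zs i).1, (zs i).2) : WeakSpace ℝ X × WeakDual ℝ X))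
      atTop (𝓝 (toWeakSpace ℝ X z.1, z.2))

/-- The `ν`-closure: all `ν`-limits of nets in `A`.  Since a neighbourhood base of a point of `Z`
can be indexed by a type in the universe of `X`, nets indexed in that universe suffice. -/
def nuClosure (A : Set (PhaseSpace X)) : Set (PhaseSpace X) :=
  {z | ∃ (ι : Type u) (_ : Preorder ι) (_ : IsDirectedOrder ι) (_ : Nonempty ι)
    (zs : ι → PhaseSpace X), (∀ i, zs i ∈ A) ∧ NuTendsto zs z}

/-- `A` is `ν`-closed if it equals its `ν`-closure. -/
def IsNuClosed (A : Set (PhaseSpace X)) : Prop := A = nuClosure A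

/-- `f` is `ν`-lower semicontinuous if `f(z) ≤ lim inf f(z_i)` whenever `z_i → z` for `ν`. -/
def IsNuLsc (f : PhaseSpace X → EReal) : Prop :=
  ∀ (ι : Type u) [Preorder ι] [IsDirectedOrder ι] [Nonempty ι]
    (zs : ι → PhaseSpace X) (z : PhaseSpace X),
    NuTendsto zs z → f z ≤ liminf (fun i => f (zs i)) atTop

end NaturalConvergence

end MonoLCS

/-! On a monotone subspace the quadratic form `coupling` is nonnegative, so c_L is convex and epi
ψ_L is just the closure of epi c_L. The coupling need not be jointly continuous, but its
polarization is continuous in each argument. Passing to the limit in one argument at a time gives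
ψ_L ≥ c (`coupling_le_of_mem_closedHull`). Hence ψ_L is the largest representative function below
c_L, and L is representable iff [ψ_L = c] ⊆ L (`isRepresentable_iff`).

The set [ψ_L = c] is stable under scaling and under translation by L. Adding a large multiple of a
positive element of L and normalizing reduces this inclusion to the unitary part. It yields ν-lower
semicontinuity because closed convex sets are closed for w × w*. Conversely, if c(z) = ψ_L(z) = 1,
rescaling points of epi c_L near (z, 1) by their heights gives points of L near z with coupling at
most 1, so ν-closedness puts z in L. -/

namespace MonoLCS

/-! ### The polarized coupling. -/

variable {X : Type u} [AddCommGroup X] [Module ℝ X] [TopologicalSpace X]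

/-- The symmetric bilinear form `⟨x, y*⟩ + ⟨y, x*⟩` polarizing the coupling. -/
noncomputable def polar (z w : PhaseSpace X) : ℝ := w.2 z.1 + z.2 w.1

theorem polar_self (z : PhaseSpace X) : polar z z = 2 * coupling z := by
  simp only [polar, coupling]; ring

theorem polar_comm (z w : PhaseSpace X) : polar z w = polar w z := by
  simp only [polar]; ring

theorem coupling_add (z w : PhaseSpace X) :
    coupling (z + w) = coupling z + polar z w + coupling w := by
  have h : coupling (z + w) = (z.2 + w.2) (z.1 + w.1) := rfl
  rw [h, map_add]
  have h' : ∀ x : X, (z.2 + w.2) x = z.2 x + w.2 x := fun _ => rfl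
  simp only [h', coupling, polar]
  ring

theorem coupling_smul (a : ℝ) (z : PhaseSpace X) : coupling (a • z) = a ^ 2 * coupling z := by
  have h : coupling (a • z) = a * z.2 (a • z.1) := rfl
  rw [h, map_smul, smul_eq_mul, coupling]
  ring

theorem polar_smul_right (a : ℝ) (z w : PhaseSpace X) : polar z (a • w) = a * polar z w := by
  have h : polar z (a • w) = a * w.2 z.1 + z.2 (a • w.1) := rfl
  rw [h, map_smul, smul_eq_mul, polar]
  ring

theorem coupling_sub (z w : PhaseSpace X) :
    coupling (z - w) = coupling z - polar z w + coupling w := by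
  have h : z - w = z + (-1 : ℝ) • w := by module
  rw [h, coupling_add, coupling_smul, polar_smul_right]
  ring

theorem continuous_polar_left (w : PhaseSpace X) : Continuous fun z => polar z w :=
  (w.2.continuous.comp continuous_fst).add ((WeakDual.eval_continuous w.1).comp continuous_snd)

/-! ### Lower semicontinuous convex hulls. -/

section Hull

variable {E : Type u} [AddCommGroup E] [Module ℝ E] [TopologicalSpace E]

/-- The closed convex hull of the epigraph of `f`. -/
def closedHull (f : E → EReal) : Set (E × ℝ) := closure (convexHull ℝ (epigraph f))

theorem closedHull_subset {f : E → EReal} {S : Set (E × ℝ)} (hc : IsClosed S)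
    (hcv : Convex ℝ S) (h : epigraph f ⊆ S) : closedHull f ⊆ S :=
  closure_minimal (convexHull_min h hcv) hc

theorem epigraph_subset_closedHull (f : E → EReal) : epigraph f ⊆ closedHull f :=
  (subset_convexHull ℝ _).trans subset_closure

/-- A convex lower semicontinuous minorant of `f` minorizes the lower semicontinuous convex hull. -/
theorem le_lscConvexHull {f g : E → EReal} (hconv : Convex ℝ (epigraph g))
    (hlsc : LowerSemicontinuous g) (hle : g ≤ f) : g ≤ lscConvexHull f := by
  have hcl : IsClosed (epigraph g) := by
    have := hlsc.isClosed_epigraph.preimage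
      (f := fun p : E × ℝ => (p.1, (p.2 : EReal)))
      (continuous_fst.prodMk (continuous_coe_real_ereal.comp continuous_snd))
    exact this
  have hsub : closedHull f ⊆ epigraph g :=
    closedHull_subset hcl hconv fun p hp => (hle p.1).trans hp
  intro z
  refine le_sInf ?_
  rintro _ ⟨t, ht, rfl⟩
  exact hsub ht

variable [IsTopologicalAddGroup E] [ContinuousSMul ℝ E]

theorem convex_closedHull (f : E → EReal) : Convex ℝ (closedHull f) :=
  (convex_convexHull ℝ _).closure

theorem closedHull_mono_right {f : E → EReal} {z : E} {s t : ℝ} (h : (z, s) ∈ closedHull f)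
    (hst : s ≤ t) : (z, t) ∈ closedHull f := by
  have hsub : closedHull f ⊆ (fun p : E × ℝ => p + (0, t - s)) ⁻¹' closedHull f := by
    refine closedHull_subset (isClosed_closure.preimage (by fun_prop))
      ((convex_closedHull f).translate_preimage_left _) fun p hp => ?_
    refine epigraph_subset_closedHull f ?_
    have hp' : f p.1 ≤ (p.2 : EReal) := hp
    change f (p.1 + 0) ≤ ((p.2 + (t - s) : ℝ) : EReal)
    rw [add_zero]
    exact hp'.trans (EReal.coe_le_coe_iff.2 (by linarith))
  simpa using hsub h

/-- The vertical fibres of the closed hull are closed and upward closed, so a finite infimum is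
attained. -/
theorem lscConvexHull_le_coe_iff {f : E → EReal} {z : E} {t : ℝ} :
    lscConvexHull f z ≤ t ↔ (z, t) ∈ closedHull f := by
  refine ⟨fun h => ?_, fun h => sInf_le ⟨t, h, rfl⟩⟩
  have hgt : ∀ s, t < s → (z, s) ∈ closedHull f := fun s hs => by
    obtain ⟨_, ⟨v, hv, rfl⟩, hvs⟩ := sInf_lt_iff.1 (h.trans_lt (EReal.coe_lt_coe_iff.2 hs))
    exact closedHull_mono_right hv (EReal.coe_lt_coe_iff.1 hvs).le
  have ht : Tendsto (fun s : ℝ => (z, s)) (𝓝[>] t) (𝓝 (z, t)) :=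
    (Continuous.tendsto (by fun_prop) t).mono_left nhdsWithin_le_nhds
  exact isClosed_closure.mem_of_tendsto ht
    (eventually_nhdsWithin_of_forall fun s hs => hgt s hs)

theorem epigraph_lscConvexHull (f : E → EReal) : epigraph (lscConvexHull f) = closedHull f :=
  Set.ext fun _ => lscConvexHull_le_coe_iff

theorem lowerSemicontinuous_lscConvexHull (f : E → EReal) :
    LowerSemicontinuous (lscConvexHull f) := by
  intro z y hy
  obtain ⟨t, hyt, htz⟩ := EReal.lt_iff_exists_real_btwn.1 hy
  have hz : (z, t) ∉ closedHull f := fun h => htz.not_ge (lscConvexHull_le_coe_iff.2 h)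
  have hcont : Continuous fun w : E => (w, t) := by fun_prop
  filter_upwards [(isClosed_closure.preimage hcont).isOpen_compl.mem_nhds hz] with w hw
  exact hyt.trans (not_le.1 fun h => hw (lscConvexHull_le_coe_iff.1 h))

end Hull

/-! ### The Penot function of a monotone subspace. -/

section Subspace

variable {L : Submodule ℝ (PhaseSpace X)}

theorem mem_epigraph_couplingOn {T : Set (PhaseSpace X)} {p : PhaseSpace X × ℝ} :
    p ∈ epigraph (couplingOn T) ↔ p.1 ∈ T ∧ coupling p.1 ≤ p.2 := by
  by_cases h : p.1 ∈ T <;> simp [epigraph, couplingOn, h]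

theorem IsMonotone.coupling_nonneg (hL : IsMonotone (L : Set (PhaseSpace X)))
    {z : PhaseSpace X} (hz : z ∈ L) : 0 ≤ coupling z := by
  have := hL z hz 0 L.zero_mem
  simpa [coupling] using this

/-- For a + b = 1, a c(p) + b c(q) - c(ap + bq) = ab c(p - q), which is nonnegative by monotonicity.
-/
theorem convex_epigraph_couplingOn (hL : IsMonotone (L : Set (PhaseSpace X))) :
    Convex ℝ (epigraph (couplingOn (L : Set (PhaseSpace X)))) := by
  intro p hp q hq a b ha hb hab
  rw [mem_epigraph_couplingOn] at *
  refine ⟨L.add_mem (L.smul_mem a hp.1) (L.smul_mem b hq.1), ?_⟩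
  have hsub := hL.coupling_nonneg (L.sub_mem hp.1 hq.1)
  rw [coupling_sub] at hsub
  change coupling (a • p.1 + b • q.1) ≤ a * p.2 + b * q.2
  have hpol : polar (a • p.1) (b • q.1) = a * b * polar p.1 q.1 := by
    rw [polar_smul_right, polar_comm, polar_smul_right, polar_comm]; ring
  rw [coupling_add, coupling_smul, coupling_smul, hpol]
  obtain rfl : b = 1 - a := by linarith
  have h1 := mul_le_mul_of_nonneg_left hp.2 ha
  have h2 := mul_le_mul_of_nonneg_left hq.2 hb
  have h3 := mul_nonneg (mul_nonneg ha hb) hsub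
  nlinarith

theorem closedHull_couplingOn (hL : IsMonotone (L : Set (PhaseSpace X))) :
    closedHull (couplingOn (L : Set (PhaseSpace X))) =
      closure (epigraph (couplingOn (L : Set (PhaseSpace X)))) := by
  rw [closedHull, (convex_epigraph_couplingOn hL).convexHull_eq]

/-- On the epigraph this is c(q - w) ≥ 0 expanded; for fixed w it is a closed condition, so it
survives closure. -/
theorem polar_le_of_mem_closedHull (hL : IsMonotone (L : Set (PhaseSpace X)))
    {p : PhaseSpace X × ℝ} (hp : p ∈ closedHull (couplingOn (L : Set (PhaseSpace X))))
    {w : PhaseSpace X} (hw : w ∈ L) : polar p.1 w ≤ p.2 + coupling w := by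
  rw [closedHull_couplingOn hL] at hp
  have hcl : IsClosed {p : PhaseSpace X × ℝ | polar p.1 w ≤ p.2 + coupling w} :=
    isClosed_le ((continuous_polar_left w).comp continuous_fst)
      (continuous_snd.add continuous_const)
  refine closure_minimal (fun q hq => ?_) hcl hp
  rw [mem_epigraph_couplingOn] at hq
  have := hL.coupling_nonneg (L.sub_mem hq.1 hw)
  rw [coupling_sub] at this
  change polar q.1 w ≤ q.2 + coupling w
  linarith [hq.2]

/-- The previous bound, with p fixed in the closure, is a closed condition on the other point q of
the epigraph. A second passage to the closure allows q = p, giving 2c(p) ≤ 2t. -/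
theorem coupling_le_of_mem_closedHull (hL : IsMonotone (L : Set (PhaseSpace X)))
    {p : PhaseSpace X × ℝ} (hp : p ∈ closedHull (couplingOn (L : Set (PhaseSpace X)))) :
    coupling p.1 ≤ p.2 := by
  have hcl : IsClosed {q : PhaseSpace X × ℝ | polar q.1 p.1 ≤ p.2 + q.2} :=
    isClosed_le ((continuous_polar_left p.1).comp continuous_fst)
      (continuous_const.add continuous_snd)
  have hmem : p ∈ {q : PhaseSpace X × ℝ | polar q.1 p.1 ≤ p.2 + q.2} := by
    have hp' := hp
    rw [closedHull_couplingOn hL] at hp'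
    refine closure_minimal (fun q hq => ?_) hcl hp'
    rw [mem_epigraph_couplingOn] at hq
    have := polar_le_of_mem_closedHull hL hp hq.1
    rw [polar_comm] at this
    change polar q.1 p.1 ≤ p.2 + q.2
    linarith [hq.2]
  have h2 : polar p.1 p.1 ≤ p.2 + p.2 := hmem
  rw [polar_self] at h2
  linarith

theorem coupling_le_penot (hL : IsMonotone (L : Set (PhaseSpace X))) (z : PhaseSpace X) :
    (coupling z : EReal) ≤ penot (L : Set (PhaseSpace X)) z := by
  refine le_sInf ?_
  rintro _ ⟨t, ht, rfl⟩
  exact EReal.coe_le_coe_iff.2 (coupling_le_of_mem_closedHull (p := (z, t)) hL ht)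

theorem mem_closedHull_of_mem {T : Set (PhaseSpace X)} {z : PhaseSpace X} (hz : z ∈ T) :
    (z, coupling z) ∈ closedHull (couplingOn T) :=
  epigraph_subset_closedHull _ (mem_epigraph_couplingOn.2 ⟨hz, le_rfl⟩)

section

variable [ContinuousSMul ℝ X]

theorem smul_mem_closedHull (hL : IsMonotone (L : Set (PhaseSpace X))) {z : PhaseSpace X}
    (hz : (z, coupling z) ∈ closedHull (couplingOn (L : Set (PhaseSpace X)))) (a : ℝ) :
    (a • z, coupling (a • z)) ∈ closedHull (couplingOn (L : Set (PhaseSpace X))) := by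
  rw [closedHull_couplingOn hL] at hz ⊢
  have hcont : Continuous fun p : PhaseSpace X × ℝ => (a • p.1, a ^ 2 * p.2) := by fun_prop
  have := map_mem_closure hcont hz (t := epigraph (couplingOn (L : Set (PhaseSpace X))))
    fun q hq => ?_
  · rw [coupling_smul]; exact this
  · rw [mem_epigraph_couplingOn] at hq ⊢
    refine ⟨L.smul_mem a hq.1, ?_⟩
    change coupling (a • q.1) ≤ a ^ 2 * q.2
    rw [coupling_smul]
    exact mul_le_mul_of_nonneg_left hq.2 (sq_nonneg a)

end

variable [IsTopologicalAddGroup X]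

/-- The map (q, t) ↦ (q + w, t + polar q w + c(w)) is continuous and preserves the epigraph, since
its height increment is exactly c(q + w) - c(q). -/
theorem add_mem_closedHull (hL : IsMonotone (L : Set (PhaseSpace X))) {z w : PhaseSpace X}
    (hz : (z, coupling z) ∈ closedHull (couplingOn (L : Set (PhaseSpace X)))) (hw : w ∈ L) :
    (z + w, coupling (z + w)) ∈ closedHull (couplingOn (L : Set (PhaseSpace X))) := by
  rw [closedHull_couplingOn hL] at hz ⊢
  have hcont : Continuous fun p : PhaseSpace X × ℝ =>
      (p.1 + w, p.2 + polar p.1 w + coupling w) :=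
    (continuous_fst.add continuous_const).prodMk
      ((continuous_snd.add ((continuous_polar_left w).comp continuous_fst)).add continuous_const)
  have := map_mem_closure hcont hz (t := epigraph (couplingOn (L : Set (PhaseSpace X))))
    fun q hq => ?_
  · rw [coupling_add]; exact this
  · rw [mem_epigraph_couplingOn] at hq ⊢
    refine ⟨L.add_mem hq.1 hw, ?_⟩
    change coupling (q.1 + w) ≤ q.2 + polar q.1 w + coupling w
    rw [coupling_add]
    linarith [hq.2]

variable [ContinuousSMul ℝ X]

theorem mem_eqCoupling_penot_iff (hL : IsMonotone (L : Set (PhaseSpace X))) {z : PhaseSpace X} :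
    z ∈ eqCoupling (penot (L : Set (PhaseSpace X))) ↔
      (z, coupling z) ∈ closedHull (couplingOn (L : Set (PhaseSpace X))) := by
  rw [← lscConvexHull_le_coe_iff]
  exact ⟨fun h => le_of_eq h, fun h => le_antisymm h (coupling_le_penot hL z)⟩

theorem isRepresentative_penot (hL : IsMonotone (L : Set (PhaseSpace X))) :
    IsRepresentative (penot (L : Set (PhaseSpace X))) where
  proper := by
    refine ⟨⟨0, ?_⟩, fun z => ((EReal.bot_lt_coe _).trans_le (coupling_le_penot hL z)).ne'⟩
    exact (lscConvexHull_le_coe_iff.2 (mem_closedHull_of_mem L.zero_mem)).trans_lt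
      (EReal.coe_lt_top _)
  convex := by
    rw [penot, epigraph_lscConvexHull]
    exact convex_closedHull _
  lsc := lowerSemicontinuous_lscConvexHull _
  coupling_le := coupling_le_penot hL

/-- If the positive part of `L` is nonempty, then `[ψ_L = c]` is contained in `L` as soon as its
unitary part is. -/
theorem eqCoupling_penot_subset (hL : IsMonotone (L : Set (PhaseSpace X)))
    (hpos : (positivePart (L : Set (PhaseSpace X))).Nonempty)
    (hunit : unitaryPart (eqCoupling (penot (L : Set (PhaseSpace X)))) ⊆
      (L : Set (PhaseSpace X))) :
    eqCoupling (penot (L : Set (PhaseSpace X))) ⊆ (L : Set (PhaseSpace X)) := by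
  intro z hz
  obtain ⟨w, hw, hw0⟩ := hpos
  rw [mem_eqCoupling_penot_iff hL] at hz
  obtain ⟨s, hs⟩ : ∃ s : ℝ, 0 < coupling (z + s • w) := by
    -- With s = r / c(w) + 1 ≥ 1, s²c(w) = s(r + c(w)) exceeds |c(z)| + s|polar z w|.
    refine ⟨(|coupling z| + |polar z w|) / coupling w + 1, ?_⟩
    rw [coupling_add, coupling_smul, polar_smul_right]
    set r := |coupling z| + |polar z w| with hr
    have hr0 : 0 ≤ r := by positivity
    have hq : 0 ≤ r / coupling w := by positivity
    have hqc : r / coupling w * coupling w = r := div_mul_cancel₀ _ hw0.ne'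
    have h1 : -|coupling z| ≤ coupling z := neg_abs_le _
    have h2 := mul_le_mul_of_nonneg_left (neg_abs_le (polar z w))
      (by linarith : 0 ≤ r / coupling w + 1)
    have h3 := mul_nonneg hq (abs_nonneg (coupling z))
    have h4 : (r / coupling w + 1) ^ 2 * coupling w =
        (r / coupling w + 1) * (r + coupling w) := by
      rw [sq, mul_assoc, add_mul (r / coupling w) 1 (coupling w), hqc, one_mul]
    rw [h4]
    have h5 := mul_nonneg hq hw0.le
    rw [hr] at *
    nlinarith
  set v := z + s • w with hv
  have hvmem := add_mem_closedHull hL hz (L.smul_mem s hw)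
  have hsq : 0 < √(coupling v) := Real.sqrt_pos.2 hs
  have hmem : (√(coupling v))⁻¹ • v ∈ L := by
    refine hunit ⟨(mem_eqCoupling_penot_iff hL).2 (smul_mem_closedHull hL hvmem _), ?_⟩
    rw [coupling_smul, inv_pow, Real.sq_sqrt hs.le, inv_mul_cancel₀ hs.ne']
  have hvL : v ∈ L := (L.smul_mem_iff (inv_ne_zero hsq.ne')).1 hmem
  exact (L.add_mem_iff_left (L.smul_mem s hw)).1 hvL

/-- Any f representing L satisfies c ≤ f ≤ ψ_L, so f = c wherever ψ_L = c. -/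
theorem isRepresentable_iff (hL : IsMonotone (L : Set (PhaseSpace X))) :
    IsRepresentable (L : Set (PhaseSpace X)) ↔
      eqCoupling (penot (L : Set (PhaseSpace X))) ⊆ (L : Set (PhaseSpace X)) := by
  constructor
  · rintro ⟨f, hf, hLf⟩ z hz
    have hle : f ≤ couplingOn (L : Set (PhaseSpace X)) := fun w => by
      by_cases hw : w ∈ (L : Set (PhaseSpace X))
      · have hfw : f w = coupling w := by rw [hLf] at hw; exact hw
        simp only [couplingOn, if_pos hw, hfw, le_refl]
      · simp only [couplingOn, if_neg hw, le_top]
    rw [hLf]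
    exact le_antisymm ((le_lscConvexHull hf.convex hf.lsc hle z).trans (le_of_eq hz))
      (hf.coupling_le z)
  · intro h
    exact ⟨_, isRepresentative_penot hL, Set.Subset.antisymm
      (fun z hz => (mem_eqCoupling_penot_iff hL).2 (mem_closedHull_of_mem hz)) h⟩

end Subspace

/-! ### Weak limits and ν-lower semicontinuity. -/

section Weak

variable [IsTopologicalAddGroup X] [ContinuousSMul ℝ X] [LocallyConvexSpace ℝ X]

/-- A closed convex subset of `Z × ℝ` is closed under limits that are taken for `w × w*` in the
first component. -/
theorem mem_of_frequently_of_tendsto_weak {C : Set (PhaseSpace X × ℝ)} (hcl : IsClosed C)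
    (hconv : Convex ℝ C) {ι : Type*} {l : Filter ι} {zs : ι → PhaseSpace X} {z : PhaseSpace X}
    {r : ℝ}
    (hlim : Tendsto (fun i => ((toWeakSpace ℝ X (zs i).1, (zs i).2) :
      WeakSpace ℝ X × WeakDual ℝ X)) l (𝓝 (toWeakSpace ℝ X z.1, z.2)))
    (hfreq : ∃ᶠ i in l, (zs i, r) ∈ C) : (z, r) ∈ C := by
  have : LocallyConvexSpace ℝ (WeakDual ℝ X) :=
    inferInstanceAs (LocallyConvexSpace ℝ (WeakBilin (topDualPairing ℝ X)))
  by_contra hz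
  obtain ⟨F, a, hFz, hFC⟩ := geometric_hahn_banach_point_closed hconv hcl hz
  -- A separating functional splits into its X and X* parts, continuous for w and w* respectively.
  have hF1 : Tendsto (fun i => F (((zs i).1, 0), 0)) l (𝓝 (F ((z.1, 0), 0))) := by
    let G : StrongDual ℝ X := F.comp ((ContinuousLinearMap.inl ℝ (PhaseSpace X) ℝ).comp
      (ContinuousLinearMap.inl ℝ X (WeakDual ℝ X)))
    have hG : Continuous fun y : WeakSpace ℝ X => G ((toWeakSpace ℝ X).symm y) :=
      WeakBilin.eval_continuous (topDualPairing ℝ X).flip G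
    exact (hG.tendsto (toWeakSpace ℝ X z.1)).comp hlim.fst_nhds
  have hF2 : Tendsto (fun i => F ((0, (zs i).2), r)) l (𝓝 (F ((0, z.2), r))) := by
    have hc : Continuous fun y : WeakDual ℝ X => F (((0 : X), y), r) :=
      F.continuous.comp ((continuous_const.prodMk continuous_id).prodMk continuous_const)
    exact (hc.tendsto z.2).comp hlim.snd_nhds
  have hsplit : ∀ w : PhaseSpace X, F (w, r) = F ((w.1, 0), 0) + F ((0, w.2), r) := fun w => by
    rw [← map_add, Prod.mk_add_mk, Prod.mk_add_mk, add_zero, zero_add, zero_add]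
  have hlimF : Tendsto (fun i => F (zs i, r)) l (𝓝 (F (z, r))) := by
    rw [hsplit z]
    exact (hF1.add hF2).congr fun i => (hsplit (zs i)).symm
  obtain ⟨i, hi, hi'⟩ := (hfreq.and_eventually (hlimF.eventually_lt_const hFz)).exists
  exact lt_asymm hi' (hFC _ hi)

theorem isNuLsc_couplingOn {L : Submodule ℝ (PhaseSpace X)}
    (hL : IsMonotone (L : Set (PhaseSpace X)))
    (h : eqCoupling (penot (L : Set (PhaseSpace X))) ⊆ (L : Set (PhaseSpace X))) :
    IsNuLsc (couplingOn (L : Set (PhaseSpace X))) := by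
  intro ι _ _ _ zs z hz
  refine not_lt.1 fun hlt => ?_
  obtain ⟨r, hr, hrz⟩ := EReal.lt_iff_exists_real_btwn.1 hlt
  have hfreq : ∃ᶠ i in atTop, (zs i, r) ∈ epigraph (couplingOn (L : Set (PhaseSpace X))) :=
    (frequently_lt_of_liminf_lt (h := hr)).mono fun i hi => hi.le
  have hmem : ∀ s : ℝ,
      (∃ᶠ i in atTop, (zs i, s) ∈ epigraph (couplingOn (L : Set (PhaseSpace X)))) →
      (z, s) ∈ closedHull (couplingOn (L : Set (PhaseSpace X))) := fun s hs => by
    have hcl : IsClosed (closedHull (couplingOn (L : Set (PhaseSpace X)))) := isClosed_closure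
    have hlim := hz.2
    have hfreq' : ∃ᶠ i in atTop, (zs i, s) ∈ closedHull (couplingOn (L : Set (PhaseSpace X))) :=
      hs.mono fun _ hi => epigraph_subset_closedHull _ hi
    exact mem_of_frequently_of_tendsto_weak hcl (convex_closedHull _) hlim hfreq'
  -- Since c(z_i) ≤ c(z), the height r may be replaced by c(z), which places z in [ψ_L = c].
  have hzL : z ∈ (L : Set (PhaseSpace X)) := h ((mem_eqCoupling_penot_iff hL).2 (hmem _
    (hfreq.mono fun i hi => mem_epigraph_couplingOn.2
      ⟨(mem_epigraph_couplingOn.1 hi).1, hz.1 i⟩)))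
  simp only [couplingOn, if_pos hzL, EReal.coe_lt_coe_iff] at hrz
  exact hrz.not_ge (coupling_le_of_mem_closedHull hL (hmem r hfreq))

end Weak

/-! ### ν-closedness. -/

section NuClosed

theorem subset_nuClosure (A : Set (PhaseSpace X)) : A ⊆ nuClosure A := fun z hz =>
  ⟨PUnit, inferInstance, inferInstance, inferInstance, fun _ => z, fun _ => hz,
    fun _ => le_rfl, tendsto_const_nhds⟩

theorem IsNuLsc.isNuClosed {T : Set (PhaseSpace X)} (h : IsNuLsc (couplingOn T)) :
    IsNuClosed T := by
  refine (subset_nuClosure T).antisymm ?_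
  rintro z ⟨ι, _, _, _, zs, hzs, hz⟩
  by_contra hzT
  have hle := h ι zs z hz
  have hbound : liminf (fun i => couplingOn T (zs i)) atTop ≤ (coupling z : EReal) := by
    refine liminf_le_of_frequently_le' (Frequently.of_forall fun i => ?_)
    simp only [couplingOn, if_pos (hzs i)]
    exact EReal.coe_le_coe_iff.2 (hz.1 i)
  simp only [couplingOn, if_neg hzT] at hle
  exact (EReal.coe_lt_top _).not_ge (hle.trans hbound)

/-- A point of the `τ × w*`-closure of `{w ∈ A | c(w) ≤ c(z)}` is a `ν`-limit of points of `A`. -/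
theorem mem_nuClosure_of_mem_closure {A : Set (PhaseSpace X)} {z : PhaseSpace X}
    (hz : z ∈ closure {w ∈ A | coupling w ≤ coupling z}) : z ∈ nuClosure A := by
  have hne : ∀ U : (𝓝 z).sets, ∃ w ∈ U.1, w ∈ A ∧ coupling w ≤ coupling z := fun U =>
    mem_closure_iff_nhds.1 hz U.1 U.2
  choose zs hzU hzA hzc using hne
  have hdir : IsDirectedOrder ((𝓝 z).sets)ᵒᵈ := ⟨fun U V =>
    ⟨OrderDual.toDual ⟨(OrderDual.ofDual U).1 ∩ (OrderDual.ofDual V).1,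
      inter_mem (OrderDual.ofDual U).2 (OrderDual.ofDual V).2⟩,
      Set.inter_subset_left, Set.inter_subset_right⟩⟩
  have hnon : Nonempty ((𝓝 z).sets)ᵒᵈ := ⟨OrderDual.toDual ⟨Set.univ, univ_mem⟩⟩
  refine ⟨((𝓝 z).sets)ᵒᵈ, inferInstance, hdir, hnon, fun U => zs (OrderDual.ofDual U),
    fun U => hzA _, fun U => hzc _, ?_⟩
  have hlim : Tendsto (fun U : ((𝓝 z).sets)ᵒᵈ => zs (OrderDual.ofDual U)) atTop (𝓝 z) := by
    intro V hV
    refine mem_atTop_sets.2 ⟨OrderDual.toDual ⟨V, hV⟩, fun U hU => ?_⟩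
    have hUV : (OrderDual.ofDual U).1 ⊆ V := hU
    exact hUV (hzU _)
  have hcont : Continuous fun w : PhaseSpace X =>
      ((toWeakSpace ℝ X w.1, w.2) : WeakSpace ℝ X × WeakDual ℝ X) :=
    ((toWeakSpaceCLM ℝ X).continuous.comp continuous_fst).prodMk continuous_snd
  exact (hcont.tendsto z).comp hlim

variable [IsTopologicalAddGroup X] [ContinuousSMul ℝ X]

theorem IsNuClosed.unitaryPart_subset {L : Submodule ℝ (PhaseSpace X)}
    (hL : IsMonotone (L : Set (PhaseSpace X))) (h : IsNuClosed (L : Set (PhaseSpace X))) :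
    unitaryPart (eqCoupling (penot (L : Set (PhaseSpace X)))) ⊆ (L : Set (PhaseSpace X)) := by
  rintro z ⟨hz, hz1⟩
  rw [mem_eqCoupling_penot_iff hL, closedHull_couplingOn hL, hz1] at hz
  rw [h]
  refine mem_nuClosure_of_mem_closure ?_
  have hpos : ∀ t : ℝ, 0 < max t 1 := fun t => lt_max_of_lt_right one_pos
  -- Dividing by √t takes (q, t) in the epigraph to coupling at most 1; the maximum with 1 keeps the
  -- map continuous everywhere and still sends (z, 1) to z.
  have hcont : Continuous fun p : PhaseSpace X × ℝ => (√(max p.2 1))⁻¹ • p.1 :=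
    ((Real.continuous_sqrt.comp (continuous_snd.max continuous_const)).inv₀
      fun p => (Real.sqrt_pos.2 (hpos p.2)).ne').smul continuous_fst
  have := map_mem_closure hcont hz
    (t := {w ∈ (L : Set (PhaseSpace X)) | coupling w ≤ coupling z}) fun q hq => ?_
  · simpa using this
  · rw [mem_epigraph_couplingOn] at hq
    refine ⟨L.smul_mem _ hq.1, ?_⟩
    rw [coupling_smul, inv_pow, Real.sq_sqrt (hpos _).le, hz1]
    rw [inv_mul_le_iff₀ (hpos _), mul_one]
    exact hq.2.trans (le_max_left _ _)

end NuClosed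

end MonoLCS

theorem theorem5p11 {X : Type u} [AddCommGroup X] [Module ℝ X] [TopologicalSpace X]
    [IsTopologicalAddGroup X] [ContinuousSMul ℝ X] [LocallyConvexSpace ℝ X] [T2Space X]
    (L : Submodule ℝ (MonoLCS.PhaseSpace X))
    (hmono : MonoLCS.IsMonotone (L : Set (MonoLCS.PhaseSpace X)))
    (hpos : (MonoLCS.positivePart (L : Set (MonoLCS.PhaseSpace X))).Nonempty) :
    List.TFAE [
      MonoLCS.IsRepresentable (L : Set (MonoLCS.PhaseSpace X)),
      MonoLCS.unitaryPart (MonoLCS.eqCoupling (MonoLCS.penot (L : Set (MonoLCS.PhaseSpace X)))) ⊆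
        (L : Set (MonoLCS.PhaseSpace X)),
      MonoLCS.IsNuLsc (MonoLCS.couplingOn (L : Set (MonoLCS.PhaseSpace X))),
      MonoLCS.IsNuClosed (L : Set (MonoLCS.PhaseSpace X))] := by
  have hrep := MonoLCS.isRepresentable_iff hmono
  tfae_have 1 → 2 := fun h z hz => hrep.1 h hz.1
  tfae_have 2 → 1 := fun h => hrep.2 (MonoLCS.eqCoupling_penot_subset hmono hpos h)
  tfae_have 1 → 3 := fun h => MonoLCS.isNuLsc_couplingOn hmono (hrep.1 h)
  tfae_have 3 → 4 := fun h => h.isNuClosed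
  tfae_have 4 → 2 := fun h => h.unitaryPart_subset hmono
  tfae_finish
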